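/- Let the integers $b(n)$, $n\ge 0$, be the coefficients of the second order mock theta function $$\mathcal{B}(q)=\sum_{n\ge 0} b(n)q^n:=\sum_{n\ge 0}\frac{q^n(-q;q^2)_n}{(q;q^2)_{n+1}},\qquad (a;q)_n:=\prod_{j=0}^{n-1}(1-aq^j).$$ Let $p$ be an odd prime and let $\ell$ be an integer with $1\le \ell\le p-1$ such that the Legendre symbol satisfies $\left(\frac{4\ell+1}{p}\right)=-1$. Then for all integers $n\ge 0$ and $k\ge 0$, $$b\left(2p^{2k+3}n+\frac{(4\ell+1)p^{2k+2}-1}{2}\right)\equiv 0\pmod 4.$$ -/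

import Mathlib

/-- The finite `q`-Pochhammer symbol `(a; q)_n = ∏_{j=0}^{n-1} (1 - a q^j)`. -/
def qPochhammer {R : Type*} [CommRing R] (a q : R) (n : ℕ) : R :=
  ∏ j ∈ Finset.range n, (1 - a * q ^ j)

/-- The `m`-th summand `q^m (-q; q^2)_m / (q; q^2)_{m+1}` of the second order mock theta
function `B(q)`, as a formal power series in `q = X` with integer coefficients. The denominator
has constant coefficient `1`, so it is invertible in `ℤ⟦X⟧`. -/
noncomputable def mockThetaBTerm (m : ℕ) : PowerSeries ℤ :=
  PowerSeries.X ^ m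
    * qPochhammer (-PowerSeries.X : PowerSeries ℤ) (PowerSeries.X ^ 2) m
    * PowerSeries.invOfUnit
        (qPochhammer (PowerSeries.X : PowerSeries ℤ) (PowerSeries.X ^ 2) (m + 1)) 1

/-- The second order mock theta function `B(q) = ∑_{m ≥ 0} q^m (-q; q^2)_m / (q; q^2)_{m+1}` as
a formal power series. As `q^m` divides the `m`-th summand, only the summands with `m ≤ n`
contribute to the coefficient of `q^n`. -/
noncomputable def mockThetaB : PowerSeries ℤ :=
  PowerSeries.mk fun n => ∑ m ∈ Finset.range (n + 1), PowerSeries.coeff n (mockThetaBTerm m)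

/-- The coefficients `b(n)` of `B(q) = ∑_{n ≥ 0} b(n) q^n`. -/
noncomputable def mockThetaBCoeff (n : ℕ) : ℤ :=
  PowerSeries.coeff n mockThetaB

/-- The denominators are indeed inverted. -/
theorem qPochhammer_mul_invOfUnit (m : ℕ) :
    qPochhammer (PowerSeries.X : PowerSeries ℤ) (PowerSeries.X ^ 2) m
      * PowerSeries.invOfUnit
          (qPochhammer (PowerSeries.X : PowerSeries ℤ) (PowerSeries.X ^ 2) m) 1 = 1 := by
  apply PowerSeries.mul_invOfUnit
  simp [qPochhammer, map_prod]

/-- The series defining `B(q)` converges to it coefficientwise. -/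
theorem hasSum_coeff_mockThetaBTerm (n : ℕ) :
    HasSum (fun m => PowerSeries.coeff n (mockThetaBTerm m)) (mockThetaBCoeff n) := by
  have h : mockThetaBCoeff n
      = ∑ m ∈ Finset.range (n + 1), PowerSeries.coeff n (mockThetaBTerm m) := by
    simp [mockThetaBCoeff, mockThetaB]
  rw [h]
  apply hasSum_sum_of_ne_finset_zero
  intro m hm
  have hlt : ¬ m ≤ n := by
    simpa [Nat.lt_succ_iff] using hm
  rw [mockThetaBTerm, mul_assoc, PowerSeries.coeff_X_pow_mul', if_neg hlt]

/-! Modulo 4 the coefficient becomes a count. Each (1+y)/(1-y) = 1 + 2(y + y^2 + ...) is 1 plus an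
even series, so a product of such factors is linear in the even parts. Hence b(N) ≡ A + 2C, where A
counts factorizations (2m+1)(2k+1) = 2N+1 and C counts quadruples (`mockThetaBCoeff_modEq_card`). If
2N+1 is not a square, swapping factors gives A = 2P, with P the number of factorizations in
increasing order. If N is even, an involution on the quadruples has P fixed points, so C ≡ P mod 2.
Thus b(N) ≡ 4P ≡ 0. In the theorem N is even and 2N+1 is p^(2k+2) times a nonresidue mod p, hence
not a square. -/

open PowerSeries in
/-- Congruence modulo the ideal `(4, X ^ L)` controls the coefficients below `L` modulo `4`. -/
theorem coeff_modEq_of_mk_eq {L N : ℕ} (hN : N < L) {f g : PowerSeries ℤ}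
    (h : Ideal.Quotient.mk (Ideal.span {(4 : PowerSeries ℤ), X ^ L}) f
      = Ideal.Quotient.mk (Ideal.span {(4 : PowerSeries ℤ), X ^ L}) g) :
    coeff N f ≡ coeff N g [ZMOD 4] := by
  obtain ⟨a, b, hab⟩ := Ideal.mem_span_pair.1 (Ideal.Quotient.eq.1 h)
  have h1 : coeff N (f - g) = 4 * coeff N a := by
    have h4 : (4 : PowerSeries ℤ) = C (4 : ℤ) := by simp
    rw [← hab, map_add, coeff_mul_X_pow', if_neg (by omega), add_zero, h4, coeff_mul_C, mul_comm]
  rw [map_sub] at h1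
  exact (Int.modEq_iff_dvd.2 ⟨coeff N a, h1⟩).symm

/-! ### Expansion of the summands modulo 4 -/

section Ring

variable {S : Type*} [CommRing S]

theorem prod_one_add_two_mul (h4 : (4 : S) = 0) (w : ℕ → S) (m : ℕ) :
    ∏ j ∈ Finset.range m, (1 + 2 * w j) = 1 + 2 * ∑ j ∈ Finset.range m, w j := by
  induction m with
  | zero => simp
  | succ m ih =>
    rw [Finset.prod_range_succ, ih, Finset.sum_range_succ]
    linear_combination (∑ j ∈ Finset.range m, w j) * w m * h4

/-- A truncated geometric series inverts `1 - y` when `y` is nilpotent. -/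
theorem inverse_eq_geom_sum {y v : S} {L : ℕ} (hy : y ^ L = 0) (hv : (1 - y) * v = 1) :
    v = ∑ k ∈ Finset.range L, y ^ k := by
  have h := mul_neg_geom_sum y L
  rw [hy, sub_zero] at h
  calc v = v * ((1 - y) * ∑ k ∈ Finset.range L, y ^ k) := by rw [h, mul_one]
    _ = ((1 - y) * v) * ∑ k ∈ Finset.range L, y ^ k := by ring
    _ = _ := by rw [hv, one_mul]

/-- The first m denominator factors pair with the numerator; the unpaired last one, v m, supplies
the geometric series in k. -/
theorem term_eq_sum_pow (h4 : (4 : S) = 0) {x : S} {L : ℕ} (hx : x ^ (L + 1) = 0) (v : ℕ → S)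
    (hv : ∀ j, (1 - x ^ (2 * j + 1)) * v j = 1) (m : ℕ) :
    x ^ m * (∏ j ∈ Finset.range m, (1 + x ^ (2 * j + 1))) * ∏ j ∈ Finset.range (m + 1), v j
      = ∑ k ∈ Finset.range (L + 1), x ^ (m + k * (2 * m + 1))
        + 2 * ∑ j ∈ Finset.range m, ∑ k ∈ Finset.range (L + 1), ∑ i ∈ Finset.range L,
            x ^ (m + k * (2 * m + 1) + (i + 1) * (2 * j + 1)) := by
  have hgeom : ∀ j, v j = ∑ k ∈ Finset.range (L + 1), (x ^ (2 * j + 1)) ^ k := fun j =>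
    inverse_eq_geom_sum (by rw [← pow_mul, mul_comm, pow_mul, hx, zero_pow (by omega)]) (hv j)
  have hfac : ∀ j, (1 + x ^ (2 * j + 1)) * v j
      = 1 + 2 * ∑ i ∈ Finset.range L, (x ^ (2 * j + 1)) ^ (i + 1) := by
    intro j
    have h := hgeom j
    rw [Finset.sum_range_succ', pow_zero] at h
    -- (1 + y) v = 2v - (1 - y) v = 2v - 1.
    linear_combination 2 * h - hv j
  have hprod : (∏ j ∈ Finset.range m, (1 + x ^ (2 * j + 1))) * ∏ j ∈ Finset.range m, v j
      = 1 + 2 * ∑ j ∈ Finset.range m, ∑ i ∈ Finset.range L, (x ^ (2 * j + 1)) ^ (i + 1) := by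
    rw [← Finset.prod_mul_distrib, Finset.prod_congr rfl fun j _ => hfac j,
      prod_one_add_two_mul h4]
  have hm : x ^ m * v m = ∑ k ∈ Finset.range (L + 1), x ^ (m + k * (2 * m + 1)) := by
    rw [hgeom m, Finset.mul_sum]
    exact Finset.sum_congr rfl fun k _ => by ring
  have hsum : (x ^ m * v m) *
        ∑ j ∈ Finset.range m, ∑ i ∈ Finset.range L, (x ^ (2 * j + 1)) ^ (i + 1)
      = ∑ j ∈ Finset.range m, ∑ k ∈ Finset.range (L + 1), ∑ i ∈ Finset.range L,
          x ^ (m + k * (2 * m + 1) + (i + 1) * (2 * j + 1)) := by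
    rw [hm, Finset.mul_sum]
    refine Finset.sum_congr rfl fun j _ => ?_
    rw [Finset.sum_mul_sum]
    exact Finset.sum_congr rfl fun k _ => Finset.sum_congr rfl fun i _ => by ring
  rw [Finset.prod_range_succ, ← hsum, ← hm]
  linear_combination (x ^ m * v m) * hprod

end Ring

open PowerSeries in
theorem coeff_mockThetaBTerm_modEq {L N : ℕ} (hN : N ≤ L) (m : ℕ) :
    coeff N (mockThetaBTerm m) ≡
      ∑ k ∈ Finset.range (L + 1), (if N = m + k * (2 * m + 1) then (1 : ℤ) else 0)
        + 2 * ∑ j ∈ Finset.range m, ∑ k ∈ Finset.range (L + 1), ∑ i ∈ Finset.range L,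
            (if N = m + k * (2 * m + 1) + (i + 1) * (2 * j + 1) then (1 : ℤ) else 0) [ZMOD 4] := by
  set v : ℕ → PowerSeries ℤ := fun j => invOfUnit (1 - X ^ (2 * j + 1)) 1 with hvdef
  have hv : ∀ j, (1 - (X : PowerSeries ℤ) ^ (2 * j + 1)) * v j = 1 := fun j =>
    mul_invOfUnit _ _ (by simp)
  have hnum : qPochhammer (-X : PowerSeries ℤ) (X ^ 2) m
      = ∏ j ∈ Finset.range m, (1 + X ^ (2 * j + 1)) :=
    Finset.prod_congr rfl fun j _ => by ring
  have hden : invOfUnit (qPochhammer (X : PowerSeries ℤ) (X ^ 2) (m + 1)) 1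
      = ∏ j ∈ Finset.range (m + 1), v j := by
    have h1 := qPochhammer_mul_invOfUnit (m + 1)
    have h2 : qPochhammer (X : PowerSeries ℤ) (X ^ 2) (m + 1)
        * ∏ j ∈ Finset.range (m + 1), v j = 1 := by
      rw [qPochhammer, ← Finset.prod_mul_distrib]
      refine Finset.prod_eq_one fun j _ => ?_
      refine Eq.trans ?_ (hv j)
      ring
    exact (IsUnit.of_mul_eq_one _ h1).mul_left_cancel (h1.trans h2.symm)
  set I : Ideal (PowerSeries ℤ) := Ideal.span {(4 : PowerSeries ℤ), X ^ (L + 1)}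
  have h4 : (4 : PowerSeries ℤ ⧸ I) = 0 := by
    have h : Ideal.Quotient.mk I 4 = 0 :=
      Ideal.Quotient.eq_zero_iff_mem.2 (Ideal.subset_span (by simp))
    rwa [map_ofNat] at h
  have hx : (Ideal.Quotient.mk I X) ^ (L + 1) = 0 := by
    rw [← map_pow]
    exact Ideal.Quotient.eq_zero_iff_mem.2 (Ideal.subset_span (by simp))
  have key := term_eq_sum_pow h4 hx (fun j => Ideal.Quotient.mk I (v j))
    (fun j => by
      have := congrArg (Ideal.Quotient.mk I) (hv j)
      simpa only [map_mul, map_sub, map_one, map_pow] using this) m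
  have h := coeff_modEq_of_mk_eq (N := N) (L := L + 1) (by omega)
    (f := mockThetaBTerm m)
    (g := ∑ k ∈ Finset.range (L + 1), X ^ (m + k * (2 * m + 1))
        + 2 * ∑ j ∈ Finset.range m, ∑ k ∈ Finset.range (L + 1), ∑ i ∈ Finset.range L,
            X ^ (m + k * (2 * m + 1) + (i + 1) * (2 * j + 1)))
    (by
      rw [mockThetaBTerm, hnum, hden]
      simpa only [map_mul, map_add, map_sum, map_prod, map_one, map_pow, map_ofNat] using key)
  have h2 : (2 : PowerSeries ℤ) = C (2 : ℤ) := by simp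
  rw [h2] at h
  simpa only [map_add, map_sum, coeff_C_mul, coeff_X_pow] using h

/-! ### Counting factorizations and quadruples -/

/-- The pairs `(m, k)` with `(2 * m + 1) * (2 * k + 1) = 2 * N + 1`. -/
def oddFactorPairs (N : ℕ) : Finset (ℕ × ℕ) :=
  (Finset.range (N + 1) ×ˢ Finset.range (N + 1)).filter fun t => N = t.1 + t.2 * (2 * t.1 + 1)

/-- The quadruples `(m, k, j, i)` with `j < m` and
`2 * N + 1 = (2 * m + 1) * (2 * k + 1) + 2 * (i + 1) * (2 * j + 1)`. -/
def oddFormQuadruples (N : ℕ) : Finset (ℕ × ℕ × ℕ × ℕ) :=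
  (Finset.range (N + 1) ×ˢ Finset.range (N + 1) ×ˢ Finset.range (N + 1) ×ˢ
    Finset.range N).filter fun t =>
      t.2.2.1 < t.1 ∧ N = t.1 + t.2.1 * (2 * t.1 + 1) + (t.2.2.2 + 1) * (2 * t.2.2.1 + 1)

theorem mem_oddFactorPairs {N m k : ℕ} :
    (m, k) ∈ oddFactorPairs N ↔ N = m + k * (2 * m + 1) := by
  simp only [oddFactorPairs, Finset.mem_filter, Finset.mem_product, Finset.mem_range,
    and_iff_right_iff_imp]
  intro h
  constructor <;> nlinarith [Nat.zero_le (k * m)]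

theorem mem_oddFormQuadruples {N m k j i : ℕ} :
    (m, k, j, i) ∈ oddFormQuadruples N ↔
      j < m ∧ N = m + k * (2 * m + 1) + (i + 1) * (2 * j + 1) := by
  simp only [oddFormQuadruples, Finset.mem_filter, Finset.mem_product, Finset.mem_range,
    and_iff_right_iff_imp]
  rintro ⟨hj, h⟩
  refine ⟨?_, ?_, ?_, ?_⟩ <;> nlinarith [Nat.zero_le (k * m), Nat.zero_le (i * j)]

theorem mockThetaBCoeff_modEq_card (N : ℕ) :
    mockThetaBCoeff N ≡ (oddFactorPairs N).card + 2 * (oddFormQuadruples N).card [ZMOD 4] := by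
  have hb : mockThetaBCoeff N
      = ∑ m ∈ Finset.range (N + 1), PowerSeries.coeff N (mockThetaBTerm m) := by
    simp [mockThetaBCoeff, mockThetaB]
  have hA : ((oddFactorPairs N).card : ℤ) = ∑ m ∈ Finset.range (N + 1),
      ∑ k ∈ Finset.range (N + 1), (if N = m + k * (2 * m + 1) then (1 : ℤ) else 0) := by
    rw [oddFactorPairs, Finset.card_filter, Finset.sum_product]
    push_cast
    rfl
  have hC : ((oddFormQuadruples N).card : ℤ) = ∑ m ∈ Finset.range (N + 1),
      ∑ j ∈ Finset.range m, ∑ k ∈ Finset.range (N + 1), ∑ i ∈ Finset.range N,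
        (if N = m + k * (2 * m + 1) + (i + 1) * (2 * j + 1) then (1 : ℤ) else 0) := by
    rw [oddFormQuadruples, Finset.card_filter, Finset.sum_product]
    push_cast
    refine Finset.sum_congr rfl fun m hm => ?_
    simp only [Finset.sum_product]
    rw [Finset.sum_comm]
    have hsub : Finset.range m ⊆ Finset.range (N + 1) :=
      Finset.range_subset_range.2 (Finset.mem_range.1 hm).le
    rw [← Finset.sum_subset hsub]
    · refine Finset.sum_congr rfl fun j hj => ?_
      simp only [Finset.mem_range.1 hj, true_and]
    · intro j _ hj
      simp only [Finset.mem_range.not.1 hj, false_and, if_false, Finset.sum_const_zero]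
  rw [hb, hA, hC, Finset.mul_sum, ← Finset.sum_add_distrib]
  exact Int.ModEq.sum fun m _ => coeff_mockThetaBTerm_modEq le_rfl m

/-- The pairs `s < t` with `(2 * s + 1) * (2 * t + 1) = 2 * N + 1`. -/
def oddFactorPairsLT (N : ℕ) : Finset (ℕ × ℕ) :=
  (oddFactorPairs N).filter fun t => t.1 < t.2

theorem card_oddFactorPairs {N : ℕ} (hN : ¬ IsSquare (2 * N + 1)) :
    (oddFactorPairs N).card = 2 * (oddFactorPairsLT N).card := by
  have hswap : ((oddFactorPairs N).filter fun t => ¬ t.1 < t.2).card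
      = (oddFactorPairsLT N).card := by
    refine Finset.card_bij' (fun t _ => t.swap) (fun t _ => t.swap) ?_ ?_
      (fun _ _ => rfl) (fun _ _ => rfl)
    · rintro ⟨m, k⟩ h
      rw [Finset.mem_filter, mem_oddFactorPairs] at h
      rw [oddFactorPairsLT, Finset.mem_filter, Prod.swap_prod_mk, mem_oddFactorPairs]
      obtain ⟨h1, h2⟩ := h
      dsimp only at h2 ⊢
      refine ⟨by rw [h1]; ring, lt_of_le_of_ne (not_lt.1 h2) ?_⟩
      rintro rfl
      exact hN ⟨2 * k + 1, by rw [h1]; ring⟩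
    · rintro ⟨m, k⟩ h
      rw [oddFactorPairsLT, Finset.mem_filter, mem_oddFactorPairs] at h
      rw [Finset.mem_filter, Prod.swap_prod_mk, mem_oddFactorPairs]
      exact ⟨by rw [h.1]; ring, not_lt.2 (le_of_lt h.2)⟩
  have h := Finset.card_filter_add_card_filter_not (s := oddFactorPairs N) (fun t => t.1 < t.2)
  rw [hswap] at h
  rw [← h, oddFactorPairsLT]
  ring

/-- An involution of the quadruples `(m, k, j, i)` in `oddFormQuadruples N`. -/
def quadrupleInvolution (t : ℕ × ℕ × ℕ × ℕ) : ℕ × ℕ × ℕ × ℕ :=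
  (t.2.2.2 + 1 + t.2.1, t.2.2.1, t.2.1, t.1 - t.2.2.1 - 1)

/-- With m = j + d + 1, the equation reads 2N+1 = (2j+1)(2k+1) + 2(d+1)(2k+1) + 2(i+1)(2j+1),
symmetric under j ↔ k, d ↔ i. -/
theorem quadrupleInvolution_mem {N : ℕ} {t : ℕ × ℕ × ℕ × ℕ} (ht : t ∈ oddFormQuadruples N) :
    quadrupleInvolution t ∈ oddFormQuadruples N := by
  obtain ⟨m, k, j, i⟩ := t
  obtain ⟨hj, h⟩ := mem_oddFormQuadruples.1 ht
  obtain ⟨d, rfl⟩ := Nat.exists_eq_add_of_lt hj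
  refine mem_oddFormQuadruples.2 ⟨by dsimp only; omega, ?_⟩
  have hd : j + d + 1 - j - 1 = d := by omega
  dsimp only
  rw [hd, h]
  ring

theorem quadrupleInvolution_involutive {N : ℕ} {t : ℕ × ℕ × ℕ × ℕ}
    (ht : t ∈ oddFormQuadruples N) : quadrupleInvolution (quadrupleInvolution t) = t := by
  obtain ⟨m, k, j, i⟩ := t
  obtain ⟨hj, -⟩ := mem_oddFormQuadruples.1 ht
  simp only [quadrupleInvolution, Prod.mk.injEq, true_and]
  omega

/-- A fixed point has k = j and m = i + 1 + j, so 2N+1 = (2j+1)(2(j+2i+2)+1). Conversely, N even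
forces s ≡ t mod 2, so (t - s)/2 = i + 1 recovers i. -/
theorem card_fixed_quadruples {N : ℕ} (hN : Even N) :
    ((oddFormQuadruples N).filter fun t => quadrupleInvolution t = t).card
      = (oddFactorPairsLT N).card := by
  refine Finset.card_bij' (fun t _ => (t.2.1, 2 * t.1 - t.2.1))
    (fun s _ => ((s.1 + s.2) / 2, s.1, s.1, (s.2 - s.1) / 2 - 1)) ?_ ?_ ?_ ?_
  · rintro ⟨m, k, j, i⟩ ht
    rw [Finset.mem_filter, mem_oddFormQuadruples] at ht
    obtain ⟨⟨hj, h⟩, hfix⟩ := ht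
    simp only [quadrupleInvolution, Prod.mk.injEq] at hfix
    obtain ⟨h1, rfl, -, -⟩ := hfix
    subst h1
    rw [oddFactorPairsLT, Finset.mem_filter, mem_oddFactorPairs]
    have h2 : 2 * (i + 1 + j) - j = 2 * i + 2 + j := by omega
    dsimp only
    rw [h2]
    exact ⟨by rw [h]; ring, by omega⟩
  · rintro ⟨s, t⟩ hs
    rw [oddFactorPairsLT, Finset.mem_filter, mem_oddFactorPairs] at hs
    obtain ⟨h, hlt⟩ := hs
    dsimp only at hlt ⊢
    have hpar : Even (s + t) := by
      have h' : N = s + t + 2 * (s * t) := by rw [h]; ring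
      rw [h', Nat.even_add] at hN
      exact hN.2 (even_two_mul _)
    obtain ⟨r, hr⟩ := hpar
    obtain ⟨d, rfl⟩ := Nat.exists_eq_add_of_lt (show s < r by omega)
    obtain rfl : t = s + 2 * d + 2 := by omega
    have h1 : (s + (s + 2 * d + 2)) / 2 = s + d + 1 := by omega
    have h2 : (s + 2 * d + 2 - s) / 2 - 1 = d := by omega
    rw [Finset.mem_filter, h1, h2, mem_oddFormQuadruples]
    refine ⟨⟨by omega, by rw [h]; ring⟩, ?_⟩
    simp only [quadrupleInvolution, Prod.mk.injEq, true_and]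
    omega
  · rintro ⟨m, k, j, i⟩ ht
    rw [Finset.mem_filter, mem_oddFormQuadruples] at ht
    obtain ⟨⟨hj, h⟩, hfix⟩ := ht
    simp only [quadrupleInvolution, Prod.mk.injEq] at hfix
    obtain ⟨h1, rfl, -, -⟩ := hfix
    subst h1
    simp only [Prod.mk.injEq, true_and]
    omega
  · rintro ⟨s, t⟩ hs
    rw [oddFactorPairsLT, Finset.mem_filter, mem_oddFactorPairs] at hs
    obtain ⟨h, hlt⟩ := hs
    dsimp only at hlt
    have hpar : Even (s + t) := by
      have h' : N = s + t + 2 * (s * t) := by rw [h]; ring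
      rw [h', Nat.even_add] at hN
      exact hN.2 (even_two_mul _)
    obtain ⟨r, hr⟩ := hpar
    simp only [Prod.mk.injEq, true_and]
    omega

theorem card_oddFormQuadruples_modEq {N : ℕ} (hN : Even N) :
    (oddFormQuadruples N).card ≡ (oddFactorPairsLT N).card [MOD 2] := by
  have hmoved : ((((oddFormQuadruples N).filter fun t => ¬ quadrupleInvolution t = t).card : ℕ)
      : ZMod 2) = 0 := by
    rw [Finset.card_eq_sum_ones, Nat.cast_sum]
    refine Finset.sum_involution (fun t _ => quadrupleInvolution t) (fun _ _ => by decide) ?_ ?_ ?_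
    · intro t ht _
      exact (Finset.mem_filter.1 ht).2
    · intro t ht
      obtain ⟨h1, h2⟩ := Finset.mem_filter.1 ht
      refine Finset.mem_filter.2 ⟨quadrupleInvolution_mem h1, ?_⟩
      rw [quadrupleInvolution_involutive h1]
      exact fun h => h2 h.symm
    · intro t ht
      exact quadrupleInvolution_involutive (Finset.mem_filter.1 ht).1
  have h := Finset.card_filter_add_card_filter_not (s := oddFormQuadruples N)
    (fun t => quadrupleInvolution t = t)
  rw [card_fixed_quadruples hN] at h
  rw [← ZMod.natCast_eq_natCast_iff, ← h, Nat.cast_add, hmoved, add_zero]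

/-- `b(N)` is divisible by `4` if `N` is even and `2 * N + 1` is not a square. -/
theorem mockThetaBCoeff_modEq_zero {N : ℕ} (hN : Even N) (hsq : ¬ IsSquare (2 * N + 1)) :
    mockThetaBCoeff N ≡ 0 [ZMOD 4] := by
  have h1 := mockThetaBCoeff_modEq_card N
  have h2 := card_oddFormQuadruples_modEq hN
  rw [card_oddFactorPairs hsq] at h1
  unfold Nat.ModEq at h2
  unfold Int.ModEq at h1 ⊢
  push_cast at h1
  omega

/-! ### The arithmetic progression -/

/-- A square multiple of an integer that is a quadratic nonresidue is not a square. -/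
theorem not_isSquare_sq_mul_of_legendreSym_eq_neg_one {p : ℕ} [Fact p.Prime] {a c : ℕ}
    (hc : c ≠ 0) (ha : legendreSym p (a : ℤ) = -1) : ¬ IsSquare (c ^ 2 * a) := by
  rintro ⟨r, hr⟩
  have hdvd : c ∣ r := by
    rw [← Nat.pow_dvd_pow_iff two_ne_zero]
    exact ⟨a, by rw [hr]; ring⟩
  obtain ⟨s, rfl⟩ := hdvd
  have has : a = s * s := by
    have : c ^ 2 * a = c ^ 2 * (s * s) := by rw [hr]; ring
    exact Nat.eq_of_mul_eq_mul_left (by positivity) this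
  rw [legendreSym.eq_neg_one_iff] at ha
  exact ha ⟨(s : ZMod p), by rw [has]; push_cast; rfl⟩

theorem corollary1 (p : ℕ) [Fact p.Prime] (hp : Odd p) (l : ℕ) (hl1 : 1 ≤ l) (hl2 : l ≤ p - 1)
    (hleg : legendreSym p (4 * (l : ℤ) + 1) = -1) (n k : ℕ) :
    mockThetaBCoeff
        (2 * p ^ (2 * k + 3) * n + ((4 * l + 1) * p ^ (2 * k + 2) - 1) / 2) ≡ 0 [ZMOD 4] := by
  -- An odd square is 1 mod 4; this makes the natural-number division by 2 exact and the index even.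
  obtain ⟨u, hu⟩ : ∃ u, (p ^ (k + 1)) ^ 2 = 4 * u + 1 := by
    obtain ⟨r, hr⟩ := hp.pow (n := k + 1)
    exact ⟨r * r + r, by rw [hr]; ring⟩
  have hpow2 : p ^ (2 * k + 2) = 4 * u + 1 := by rw [← hu]; ring
  have hpow3 : p ^ (2 * k + 3) = p * (4 * u + 1) := by rw [← hpow2]; ring
  have hdiv : ((4 * l + 1) * (4 * u + 1) - 1) / 2 = 2 * (4 * l * u + l + u) := by
    have : (4 * l + 1) * (4 * u + 1) = 4 * (4 * l * u + l + u) + 1 := by ring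
    omega
  rw [hpow2, hpow3, hdiv]
  refine mockThetaBCoeff_modEq_zero ⟨p * (4 * u + 1) * n + (4 * l * u + l + u), by ring⟩ ?_
  have hfac : 2 * (2 * (p * (4 * u + 1)) * n + 2 * (4 * l * u + l + u)) + 1
      = (p ^ (k + 1)) ^ 2 * (4 * l + 1 + 4 * p * n) := by
    rw [hu]; ring
  rw [hfac]
  refine not_isSquare_sq_mul_of_legendreSym_eq_neg_one (p := p)
    (pow_ne_zero _ (Fact.out : p.Prime).ne_zero) ?_
  -- The term 4pn vanishes mod p, leaving 4l + 1.
  rw [legendreSym.eq_neg_one_iff] at hleg ⊢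
  push_cast at hleg ⊢
  simpa using hleg
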